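/- **Conventions.** A composition algebra is a real unital (not necessarily associative) algebra $\mathbb K$ with a non-degenerate quadratic form $|x|^2$ satisfying $|xy|^2=|x|^2|y|^2$. Put $\langle x,y\rangle=\tfrac12(|x+y|^2-|x|^2-|y|^2)$, $\operatorname{Re}x=\langle x,1\rangle$, $\bar x=2(\operatorname{Re}x)1-x$, and $\mathbb K'=\{x:\operatorname{Re}x=0\}$; let $\nu=\dim_{\mathbb R}\mathbb K$. For a real vector space $V$ with a non-degenerate quadratic form, $\mathfrak{so}(V)$ is the Lie algebra of linear maps of $V$ that are skew with respect to the form; $\dotplus$ denotes the direct sum of vector spaces. Let $\mathbb R,\mathbb C,\mathbb H,\mathbb O$ be the real numbers, complex numbers, quaternions and octonions with the square of the Euclidean norm, and let $\tilde{\mathbb C},\tilde{\mathbb H},\tilde{\mathbb O}$ be the split forms of $\mathbb C,\mathbb H,\mathbb O$, obtained by the Cayley–Dickson process from $\mathbb R,\mathbb C,\mathbb H$ respectively with a new unit $i$ such that $i^2=+1$, so that $|a+bi|^2=|a|^2-|b|^2$. Let $H_2(\mathbb K)$ be the space of hermitian $2\times2$ matrices over $\mathbb K$ with the Jordan product $X\cdot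 Y=XY+YX$, $H_2'(\mathbb K)$ its subspace of traceless matrices, $\operatorname{Der}H_2(\mathbb K)$ the Lie algebra of derivations of this algebra, $R_A$ the map $X\mapsto X\cdot A$, and $\langle A,B\rangle=\operatorname{Re}\operatorname{tr}(A\cdot B)$. For $x,y\in\mathbb K'$ let $D_{x,y}=4S_{x,y}\in\mathfrak{so}(\mathbb K')$, where $S_{x,y}(z)=\langle x,z\rangle y-\langle y,z\rangle x$. For composition algebras $\mathbb K_1,\mathbb K_2$ define $$L_2(\mathbb K_1,\mathbb K_2)=\operatorname{Der}H_2(\mathbb K_1)\ \dotplus\ H_2'(\mathbb K_1)\otimes\mathbb K_2'\ \dotplus\ \mathfrak{so}(\mathbb K_2')$$ with the antisymmetric bilinear bracket that extends the Lie brackets of $\operatorname{Der}H_2(\mathbb K_1)$ and $\mathfrak{so}(\mathbb K_2')$ and satisfies, for $D\in\operatorname{Der}H_2(\mathbb K_1)$, $E\in\mathfrak{so}(\mathbb K_2')$, $A,B\in H_2'(\mathbb K_1)$, $x,y\in\mathbb K_2'$, $$[D,E]=0,\quad [D,A\otimes x]=D(A)\otimes x,\quad [E,A\otimes x]=A\otimes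 E(x),$$ $$[A\otimes x,B\otimes y]=\tfrac14\langle A,B\rangle D_{x,y}-\langle x,y\rangle[R_A,R_B].$$ **Theorem.** Let $\mathbb K_1\in\{\mathbb R,\mathbb C,\mathbb H,\mathbb O\}$. 1. For $\mathbb K_2\in\{\mathbb R,\mathbb C,\mathbb H,\mathbb O\}$ there are isomorphisms (bracket-preserving linear bijections, so that in particular $L_2(\mathbb K_1,\mathbb K_2)$ is a Lie algebra) $$L_2(\mathbb K_1,\mathbb K_2)\cong\mathfrak{so}(\mathbb K_1\dotplus\mathbb K_2)\quad\text{and}\quad L_2(\mathbb K_1,\mathbb K_2)\cong\mathfrak{so}(\nu_1+\nu_2),$$ where $\mathbb K_1\dotplus\mathbb K_2$ carries the form $|x_1|^2+|x_2|^2$ and $\mathfrak{so}(n)$ is the Lie algebra of real skew-symmetric $n\times n$ matrices. 2. For $\tilde{\mathbb K}_2\in\{\tilde{\mathbb C},\tilde{\mathbb H},\tilde{\mathbb O}\}$, of dimension $\nu_2$, there is likewise an isomorphism $$L_2(\mathbb K_1,\tilde{\mathbb K}_2)\cong\mathfrak{so}(\nu_1+\tfrac12\nu_2,\ \tfrac12\nu_2),$$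 where $\mathfrak{so}(s,t)=\{M\in\mathbb R^{(s+t)\times(s+t)}:M^{T}G+GM=0\}$ and $G$ is the diagonal matrix with $s$ diagonal entries of one sign followed by $t$ of the other sign. -/

import Mathlib

open scoped TensorProduct Quaternion

attribute [local instance 100] LieRing.ofAssociativeRing

noncomputable section

namespace MagicSquare

/-! ### Composition algebras -/

/-- A (not necessarily associative) unital real composition algebra: an algebra with a
non-degenerate quadratic form `N` (written `|x|²` in the literature) such that
`N (x * y) = N x * N y`. -/
structure CompAlg where
  carrier : Type
  [ring : NonAssocRing carrier]
  [module : Module ℝ carrier]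
  [smulComm : SMulCommClass ℝ carrier carrier]
  [tower : IsScalarTower ℝ carrier carrier]
  [nontrivial : Nontrivial carrier]
  /-- the quadratic form `|x|²` -/
  N : QuadraticForm ℝ carrier
  nondegenerate : ∀ x, (∀ y, QuadraticMap.associated N x y = 0) → x = 0
  N_mul : ∀ x y, N (x * y) = N x * N y

namespace CompAlg

instance : CoeSort CompAlg Type := ⟨CompAlg.carrier⟩

attribute [instance] CompAlg.ring CompAlg.module CompAlg.smulComm CompAlg.tower
  CompAlg.nontrivial

variable (K : CompAlg)

/-- The symmetric bilinear form `⟨x, y⟩ = (|x + y|² - |x|² - |y|²) / 2`. -/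
def form : LinearMap.BilinForm ℝ K := QuadraticMap.associated K.N

theorem form_eq (x y : K) : K.form x y = (K.N (x + y) - K.N x - K.N y) / 2 := by
  simp [form, QuadraticMap.associated_apply]; ring

theorem form_self (x : K) : K.form x x = K.N x :=
  QuadraticMap.associated_eq_self_apply ℝ K.N x

theorem form_comm (x y : K) : K.form x y = K.form y x :=
  (QuadraticMap.associated_isSymm ℝ K.N) x y

theorem N_add (x y : K) : K.N (x + y) = K.N x + K.N y + 2 * K.form x y := by
  rw [form_eq]; ring

/-- The linear functional `Re x = ⟨x, 1⟩`. -/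
def re : K →ₗ[ℝ] ℝ := K.form 1

/-- Conjugation `x̄ = 2 (Re x) 1 - x`: it fixes the scalars and is `-1` on their orthogonal
complement. -/
def conj : K →ₗ[ℝ] K := (2 : ℝ) • K.re.smulRight (1 : K) - LinearMap.id

theorem conj_apply (x : K) : K.conj x = (2 * K.re x) • (1 : K) - x := by
  simp [conj, smul_smul]

theorem ext_form {x y : K} (h : ∀ z, K.form x z = K.form y z) : x = y := by
  rw [← sub_eq_zero]
  apply K.nondegenerate
  intro z
  change K.form (x - y) z = 0
  simp [h]

theorem N_one : K.N 1 = 1 := by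
  by_contra h
  have h0 : ∀ x : K, K.N x = 0 := by
    intro x
    have h1 := K.N_mul x 1
    rw [mul_one] at h1
    have h2 : K.N x * (1 - K.N 1) = 0 := by linarith
    rcases mul_eq_zero.1 h2 with h3 | h3
    · exact h3
    · exact absurd (by linarith) h
  exact one_ne_zero (K.ext_form (x := (1 : K)) (y := 0) (fun z => by simp [form_eq, h0]))

theorem form_mul_mul_left (x a b : K) : K.form (x * a) (x * b) = K.N x * K.form a b := by
  rw [form_eq, form_eq, ← mul_add, K.N_mul, K.N_mul, K.N_mul]; ring

theorem form_mul_mul_right (x a b : K) : K.form (a * x) (b * x) = K.form a b * K.N x := by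
  rw [form_eq, form_eq, ← add_mul, K.N_mul, K.N_mul, K.N_mul]; ring

theorem form_exchange (x y a b : K) :
    K.form (x * a) (y * b) + K.form (y * a) (x * b) = 2 * K.form x y * K.form a b := by
  have h := K.form_mul_mul_left (x + y) a b
  rw [add_mul, add_mul, map_add, map_add, LinearMap.add_apply, LinearMap.add_apply,
    K.form_mul_mul_left, K.form_mul_mul_left, K.N_add] at h
  linarith

/-- Left multiplication by `x̄` is adjoint to left multiplication by `x`. -/
theorem form_mul_left (x a b : K) : K.form (x * a) b = K.form a (K.conj x * b) := by
  have h := K.form_exchange x 1 a b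
  rw [one_mul, one_mul] at h
  rw [conj_apply, sub_mul, map_sub, smul_mul_assoc, one_mul, map_smul, smul_eq_mul,
    show K.re x = K.form 1 x from rfl, K.form_comm 1 x]
  linarith

/-- Right multiplication by `x̄` is adjoint to right multiplication by `x`. -/
theorem form_mul_right (x a b : K) : K.form (a * x) b = K.form a (b * K.conj x) := by
  have h := K.form_exchange a b x 1
  rw [mul_one, mul_one, K.form_comm (b * x) a] at h
  rw [conj_apply, mul_sub, map_sub, mul_smul_comm, mul_one, map_smul, smul_eq_mul,
    show K.re x = K.form 1 x from rfl, K.form_comm 1 x]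
  linarith

theorem re_one : K.re 1 = 1 := by
  change K.form 1 1 = 1
  rw [form_self, N_one]

theorem conj_one : K.conj 1 = 1 := by
  rw [conj_apply, re_one, mul_one, two_smul]; abel

theorem re_conj (x : K) : K.re (K.conj x) = K.re x := by
  rw [conj_apply, map_sub, map_smul, re_one, smul_eq_mul]; ring

theorem conj_conj (x : K) : K.conj (K.conj x) = x := by
  rw [conj_apply, re_conj, conj_apply]; abel

theorem form_conj_conj (x y : K) : K.form (K.conj x) (K.conj y) = K.form x y := by
  have h1 : K.re y = K.form y 1 := K.form_comm 1 y
  have h2 : K.re x = K.form x 1 := K.form_comm 1 x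
  have h3 : K.form 1 1 = 1 := K.re_one
  have h4 : K.re y = K.form 1 y := rfl
  simp only [conj_apply, map_sub, map_smul, LinearMap.sub_apply, LinearMap.smul_apply,
    smul_eq_mul, h3, ← h2, ← h4]
  ring

theorem N_conj (x : K) : K.N (K.conj x) = K.N x := by
  rw [← form_self, form_conj_conj, form_self]

theorem conj_mul (x y : K) : K.conj (x * y) = K.conj y * K.conj x := by
  apply K.ext_form
  intro z
  have e1 : ∀ u w, K.form (u * K.conj w) z = K.form u (z * w) := by
    intro u w
    rw [K.form_mul_right, K.conj_conj]
  have h1 := e1 1 (x * y)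
  rw [one_mul] at h1
  have h2 := K.form_mul_left (K.conj z) 1 (x * y)
  rw [mul_one, K.conj_conj] at h2
  have h3 := K.form_mul_right (K.conj y) (K.conj z) x
  rw [K.conj_conj] at h3
  have h4 := K.form_mul_left (K.conj z) (K.conj y) x
  rw [K.conj_conj] at h4
  rw [h1, ← h2, ← h3, h4, e1]

theorem mul_conj_add (x y : K) :
    x * K.conj y + y * K.conj x = (2 * K.form x y) • (1 : K) := by
  apply K.ext_form
  intro z
  have h := K.form_exchange 1 z x y
  rw [one_mul, one_mul] at h
  rw [map_add, LinearMap.add_apply, K.form_mul_right, K.form_mul_right, K.conj_conj, K.conj_conj,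
    map_smul, LinearMap.smul_apply, smul_eq_mul, K.form_comm y]
  linarith

theorem eq_of_conj_eq {x : K} (h : K.conj x = x) : x = K.re x • (1 : K) := by
  rw [conj_apply, sub_eq_iff_eq_add, ← two_smul ℝ x, mul_smul] at h
  exact (smul_right_injective K (two_ne_zero' ℝ) h).symm

/-- The subspace `K'` of `K` orthogonal to the scalars. -/
def im : Submodule ℝ K := LinearMap.ker K.re

/-- The form `⟨x, y⟩` on `K'`. -/
def imForm : LinearMap.BilinForm ℝ K.im := K.form.restrict K.im

theorem imForm_apply (x y : K.im) : K.imForm x y = K.form (x : K) (y : K) := rfl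

theorem imForm_comm (x y : K.im) : K.imForm x y = K.imForm y x := K.form_comm _ _

/-- `so(K')`, the linear maps of `K'` that are skew for `⟨x, y⟩`. -/
abbrev soIm : LieSubalgebra ℝ (Module.End ℝ K.im) := skewAdjointLieSubalgebra K.imForm

/-- The rotation generator `S_{x,y} z = ⟨x, z⟩ y - ⟨y, z⟩ x` of `K'`, as a bilinear map in
`x`, `y` with values in `so(K')`. -/
def S : K.im →ₗ[ℝ] K.im →ₗ[ℝ] K.soIm :=
  LinearMap.mk₂ ℝ
    (fun x y => ⟨(K.imForm x).smulRight y - (K.imForm y).smulRight x, by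
      change LinearMap.IsAdjointPair _ _ _ _
      intro z w
      change K.imForm (K.imForm x z • y - K.imForm y z • x) w
        = -K.imForm z (K.imForm x w • y - K.imForm y w • x)
      simp only [map_sub, map_smul, LinearMap.sub_apply, LinearMap.smul_apply, smul_eq_mul,
        K.imForm_comm z]
      ring⟩)
    (by intro x x' y; ext z : 2; simp [add_smul]; abel)
    (by intro c x y; ext z : 2; simp [mul_smul, smul_sub, smul_comm c])
    (by intro x x' y; ext z : 2; simp [add_smul]; abel)
    (by intro c x y; ext z : 2; simp [mul_smul, smul_sub, smul_comm c])

theorem S_apply (x y z : K.im) :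
    (K.S x y : Module.End ℝ K.im) z = K.imForm x z • y - K.imForm y z • x := rfl

/-- The quadratic form `|x₁ + x₂|² = |x₁|² + |x₂|²` on `K₁ ∔ K₂`. -/
def sumN (K₁ K₂ : CompAlg) : QuadraticForm ℝ (K₁ × K₂) := K₁.N.prod K₂.N

/-- `so(K₁ ∔ K₂)`, the linear maps of `K₁ ∔ K₂` that are skew for the form `|x₁|² + |x₂|²`. -/
abbrev soSum (K₁ K₂ : CompAlg) : LieSubalgebra ℝ (Module.End ℝ (K₁ × K₂)) :=
  skewAdjointLieSubalgebra (QuadraticMap.associated (sumN K₁ K₂) : LinearMap.BilinForm ℝ (K₁ × K₂))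

/-- The dimension `ν` of `K` over `ℝ`. -/
def dim : ℕ := Module.finrank ℝ K

/-! ### The algebras `R, C, H, O` and the split algebras -/

/-- The real numbers, with `|x|² = ‖x‖²`. -/
def R : CompAlg where
  carrier := ℝ
  N := LinearMap.BilinMap.toQuadraticMap (innerₗ ℝ)
  nondegenerate x h := by
    have := h x
    rwa [QuadraticMap.associated_eq_self_apply, LinearMap.BilinMap.toQuadraticMap_apply,
      innerₗ_apply_apply, inner_self_eq_zero] at this
  N_mul x y := by
    simp only [LinearMap.BilinMap.toQuadraticMap_apply, innerₗ_apply_apply,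
      real_inner_self_eq_norm_sq, norm_mul, mul_pow]

/-- The complex numbers, with `|x|² = ‖x‖²`. -/
def C : CompAlg where
  carrier := ℂ
  N := LinearMap.BilinMap.toQuadraticMap (innerₗ ℂ)
  nondegenerate x h := by
    have := h x
    rwa [QuadraticMap.associated_eq_self_apply, LinearMap.BilinMap.toQuadraticMap_apply,
      innerₗ_apply_apply, inner_self_eq_zero] at this
  N_mul x y := by
    simp only [LinearMap.BilinMap.toQuadraticMap_apply, innerₗ_apply_apply,
      real_inner_self_eq_norm_sq, norm_mul, mul_pow]

/-- Hamilton's quaternions, with `|x|² = ‖x‖²`. -/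
def H : CompAlg where
  carrier := ℍ[ℝ]
  N := LinearMap.BilinMap.toQuadraticMap (innerₗ ℍ[ℝ])
  nondegenerate x h := by
    have := h x
    rwa [QuadraticMap.associated_eq_self_apply, LinearMap.BilinMap.toQuadraticMap_apply,
      innerₗ_apply_apply, inner_self_eq_zero] at this
  N_mul x y := by
    simp only [LinearMap.BilinMap.toQuadraticMap_apply, innerₗ_apply_apply,
      real_inner_self_eq_norm_sq, norm_mul, mul_pow]

/-- The vector space of the Cayley-Dickson double of `K` with sign parameter `γ`. -/
def Double (K : CompAlg) (_γ : ℝ) : Type := K × K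

namespace Double

variable (γ : ℝ)

instance : AddCommGroup (Double K γ) := inferInstanceAs (AddCommGroup (K × K))

instance : Module ℝ (Double K γ) := inferInstanceAs (Module ℝ (K × K))

/-- The Cayley-Dickson product `(a, b) (c, d) = (a c + γ d̄ b, d a + b c̄)`. -/
instance : Mul (Double K γ) :=
  ⟨fun x y => (x.1 * y.1 + γ • (K.conj y.2 * x.2), y.2 * x.1 + x.2 * K.conj y.1)⟩

instance : One (Double K γ) := ⟨((1 : K), (0 : K))⟩

variable {K γ}

@[ext] theorem ext {x y : Double K γ} (h₁ : x.1 = y.1) (h₂ : x.2 = y.2) : x = y :=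
  Prod.ext h₁ h₂

theorem mul_fst (x y : Double K γ) :
    (x * y).1 = x.1 * y.1 + γ • (K.conj y.2 * x.2) := rfl
theorem mul_snd (x y : Double K γ) : (x * y).2 = y.2 * x.1 + x.2 * K.conj y.1 := rfl
theorem one_fst : (1 : Double K γ).1 = 1 := rfl
theorem one_snd : (1 : Double K γ).2 = 0 := rfl
theorem zero_fst : (0 : Double K γ).1 = 0 := rfl
theorem zero_snd : (0 : Double K γ).2 = 0 := rfl
theorem add_fst (x y : Double K γ) : (x + y).1 = x.1 + y.1 := rfl
theorem add_snd (x y : Double K γ) : (x + y).2 = x.2 + y.2 := rfl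
theorem smul_fst (r : ℝ) (x : Double K γ) : (r • x).1 = r • x.1 := rfl
theorem smul_snd (r : ℝ) (x : Double K γ) : (r • x).2 = r • x.2 := rfl

variable (K γ)

instance : NonAssocRing (Double K γ) where
  __ := (inferInstance : AddCommGroup (Double K γ))
  left_distrib x y z := by
    apply ext <;> simp only [mul_fst, mul_snd, add_fst, add_snd, map_add, mul_add, add_mul,
      smul_add] <;> abel
  right_distrib x y z := by
    apply ext <;> simp only [mul_fst, mul_snd, add_fst, add_snd, mul_add, add_mul,
      smul_add] <;> abel
  zero_mul x := by apply ext <;> simp [mul_fst, mul_snd, zero_fst, zero_snd]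
  mul_zero x := by apply ext <;> simp [mul_fst, mul_snd, zero_fst, zero_snd]
  one_mul x := by apply ext <;> simp [mul_fst, mul_snd, one_fst, one_snd]
  mul_one x := by apply ext <;> simp [mul_fst, mul_snd, one_fst, one_snd, conj_one]

instance : SMulCommClass ℝ (Double K γ) (Double K γ) where
  smul_comm r x y := by
    apply ext <;> simp [mul_fst, mul_snd, smul_fst, smul_snd, smul_comm γ r, smul_mul_assoc,
      mul_smul_comm]

instance : IsScalarTower ℝ (Double K γ) (Double K γ) where
  smul_assoc r x y := by
    apply ext <;> simp [mul_fst, mul_snd, smul_fst, smul_snd, smul_comm γ r, smul_mul_assoc,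
      mul_smul_comm]

instance : Nontrivial (Double K γ) := inferInstanceAs (Nontrivial (K × K))

/-- The quadratic form `|(a, b)|² = |a|² - γ |b|²`. -/
def N : QuadraticForm ℝ (Double K γ) := K.N.prod ((-γ) • K.N)

theorem N_apply (x : Double K γ) : N K γ x = K.N x.1 - γ * K.N x.2 := by
  change K.N x.1 + (-γ) * K.N x.2 = _
  ring

end Double

/-- The Cayley-Dickson process: the double of an associative composition algebra with sign
parameter `γ ≠ 0`, in which the new unit `i = (0, 1)` has `i² = γ`. -/
def double (K : CompAlg) (γ : ℝ) (hγ : γ ≠ 0) (assoc : ∀ x y z : K, x * y * z = x * (y * z)) :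
    CompAlg where
  carrier := Double K γ
  N := Double.N K γ
  nondegenerate x h := by
    have key : ∀ y : Double K γ, QuadraticMap.associated (Double.N K γ) x y
        = K.form x.1 y.1 - γ * K.form x.2 y.2 := by
      intro y
      simp only [QuadraticMap.associated_apply, Double.N_apply, form_eq, Double.add_fst,
        Double.add_snd]
      simp
      ring
    apply Double.ext
    · apply K.nondegenerate
      intro z
      have h1 := (key ((z, 0) : K × K)).symm.trans (h _)
      change K.form _ _ = 0
      simpa using h1
    · apply K.nondegenerate
      intro z
      have h1 := (key ((0, z) : K × K)).symm.trans (h _)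
      change K.form _ _ = 0
      simpa [hγ] using h1
  N_mul x y := by
    have h1 : K.form (x.1 * y.1) (K.conj y.2 * x.2) = K.form (y.2 * x.1) (x.2 * K.conj y.1) := by
      rw [← K.form_mul_left, ← K.form_mul_right, assoc]
    simp only [Double.N_apply, Double.mul_fst, Double.mul_snd, N_add, QuadraticMap.map_smul,
      N_mul, N_conj, map_smul, smul_eq_mul, h1]
    ring

/-- The octonions, the Cayley-Dickson double of the quaternions with `i² = -1`. -/
def O : CompAlg := H.double (-1) (by norm_num) (mul_assoc (G := ℍ[ℝ]))

/-- The split complex numbers. -/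
def splitC : CompAlg := R.double 1 one_ne_zero (mul_assoc (G := ℝ))

/-- The split quaternions. -/
def splitH : CompAlg := C.double 1 one_ne_zero (mul_assoc (G := ℂ))

/-- The split octonions. -/
def splitO : CompAlg := H.double 1 one_ne_zero (mul_assoc (G := ℍ[ℝ]))

end CompAlg

/-! ### Derivations and hermitian matrices -/

/-- The Lie algebra of derivations of a (non-associative) real algebra. -/
def Der (A : Type*) [NonUnitalNonAssocRing A] [Module ℝ A] [SMulCommClass ℝ A A]
    [IsScalarTower ℝ A A] : LieSubalgebra ℝ (Module.End ℝ A) where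
  carrier := {D | ∀ x y, D (x * y) = D x * y + x * D y}
  add_mem' {D E} hD hE x y := by
    simp only [LinearMap.add_apply, hD x y, hE x y, add_mul, mul_add]; abel
  zero_mem' x y := by simp
  smul_mem' r D hD x y := by
    simp only [LinearMap.smul_apply, hD x y, smul_add, smul_mul_assoc, mul_smul_comm]
  lie_mem' {D E} hD hE x y := by
    simp only [LieRing.of_associative_ring_bracket, LinearMap.sub_apply, Module.End.mul_apply,
      hE x y, hD x y, map_add, hD _ _, hE _ _, sub_mul, mul_sub]
    abel

variable (K : CompAlg)

/-- The hermitian `2 × 2` matrices over `K`, as a subspace of all matrices. -/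
def herm : Submodule ℝ (Matrix (Fin 2) (Fin 2) K) where
  carrier := {X | ∀ i j, K.conj (X j i) = X i j}
  add_mem' {X Y} hX hY i j := by simp [hX i j, hY i j]
  zero_mem' i j := by simp
  smul_mem' r X hX i j := by simp [hX i j]

/-- The Jordan algebra `H₂(K)` of hermitian `2 × 2` matrices over `K`. -/
def H2 : Type := herm K

namespace H2

instance : AddCommGroup (H2 K) := inferInstanceAs (AddCommGroup (herm K))

instance : Module ℝ (H2 K) := inferInstanceAs (Module ℝ (herm K))

variable {K}

/-- The underlying matrix of an element of `H₂(K)`. -/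
def mat : H2 K →ₗ[ℝ] Matrix (Fin 2) (Fin 2) K := (herm K).subtype

theorem mat_injective : Function.Injective (mat (K := K)) := Subtype.val_injective

@[ext] theorem ext {X Y : H2 K} (h : mat X = mat Y) : X = Y := mat_injective h

theorem conj_mat (X : H2 K) (i j : Fin 2) : K.conj (mat X j i) = mat X i j := X.2 i j

/-- The Jordan product `X · Y = X Y + Y X`. -/
instance : Mul (H2 K) :=
  ⟨fun X Y => ⟨mat X * mat Y + mat Y * mat X, fun i j => by
    simp only [Matrix.add_apply, Matrix.mul_apply, map_add, map_sum, K.conj_mul, conj_mat]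
    rw [add_comm]⟩⟩

theorem mat_mul (X Y : H2 K) : mat (X * Y) = mat X * mat Y + mat Y * mat X := rfl

instance : One (H2 K) := ⟨⟨1, fun i j => by
  rcases eq_or_ne i j with rfl | h
  · simp [K.conj_one]
  · simp [Matrix.one_apply_ne h, Matrix.one_apply_ne h.symm]⟩⟩

theorem mat_one : mat (1 : H2 K) = 1 := rfl

variable (K)

instance : NonUnitalNonAssocRing (H2 K) where
  __ := (inferInstance : AddCommGroup (H2 K))
  left_distrib X Y Z := by ext1; simp only [mat_mul, map_add, mul_add, add_mul]; abel
  right_distrib X Y Z := by ext1; simp only [mat_mul, map_add, mul_add, add_mul]; abel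
  zero_mul X := by ext1; simp [mat_mul]
  mul_zero X := by ext1; simp [mat_mul]

instance : SMulCommClass ℝ (H2 K) (H2 K) where
  smul_comm r X Y := by ext1; simp [mat_mul]

instance : IsScalarTower ℝ (H2 K) (H2 K) where
  smul_assoc r X Y := by ext1; simp [mat_mul]

variable {K}

theorem mul_comm' (X Y : H2 K) : X * Y = Y * X := by
  ext1; rw [mat_mul, mat_mul, add_comm]

theorem mul_one' (X : H2 K) : X * 1 = (2 : ℝ) • X := by
  ext1; rw [mat_mul, mat_one, mul_one, one_mul, map_smul, two_smul]

/-- The real trace `Re (tr X)`. -/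
def reTr : H2 K →ₗ[ℝ] ℝ := K.re ∘ₗ Matrix.traceLinearMap (Fin 2) ℝ K ∘ₗ mat

theorem reTr_apply (X : H2 K) : reTr X = K.re (mat X).trace := rfl

/-- The symmetric bilinear form `⟨A, B⟩ = Re (tr (A · B))`. -/
def form : H2 K →ₗ[ℝ] H2 K →ₗ[ℝ] ℝ := (LinearMap.mul ℝ (H2 K)).compr₂ reTr

theorem form_apply (A B : H2 K) : form A B = reTr (A * B) := rfl

theorem form_comm (A B : H2 K) : form A B = form B A := by
  rw [form_apply, form_apply, mul_comm']

variable (K)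

/-- The subspace `H₂'(K)` of traceless matrices. -/
def traceless : Submodule ℝ (H2 K) where
  carrier := {A | (mat A).trace = 0}
  add_mem' {A B} hA hB := by
    change (mat A + mat B).trace = 0
    rw [Matrix.trace_add, hA, hB, add_zero]
  zero_mem' := Matrix.trace_zero _ _
  smul_mem' r A hA := by
    change (r • mat A).trace = 0
    rw [Matrix.trace_smul, hA, smul_zero]

variable {K}

theorem mem_traceless {A : H2 K} : A ∈ traceless K ↔ (mat A).trace = 0 := Iff.rfl

theorem mat_zero_zero (X : H2 K) : mat X 0 0 = K.re (mat X 0 0) • (1 : K) :=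
  K.eq_of_conj_eq (conj_mat X 0 0)

theorem mat_one_one (X : H2 K) : mat X 1 1 = K.re (mat X 1 1) • (1 : K) :=
  K.eq_of_conj_eq (conj_mat X 1 1)

theorem trace_eq (X : H2 K) : (mat X).trace = reTr X • (1 : K) := by
  rw [reTr_apply, Matrix.trace_fin_two, mat_zero_zero X, mat_one_one X, ← add_smul, map_smul,
    K.re_one, smul_eq_mul, mul_one]

theorem reTr_one : reTr (1 : H2 K) = 2 := by
  rw [reTr_apply, mat_one, Matrix.trace_fin_two, Matrix.one_apply_eq, Matrix.one_apply_eq,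
    map_add, K.re_one]
  norm_num

theorem mem_traceless_iff {A : H2 K} : A ∈ traceless K ↔ reTr A = 0 := by
  rw [mem_traceless, trace_eq]
  simp

/-- The Jordan product of traceless matrices is a real multiple of the identity. -/
theorem mul_traceless {A B : H2 K} (hA : A ∈ traceless K) (hB : B ∈ traceless K) :
    A * B = (form A B / 2) • 1 := by
  obtain ⟨c, hc⟩ : ∃ c : ℝ, A * B = c • 1 := by
    have a1 : mat A 1 1 = -mat A 0 0 := by
      have := mem_traceless.1 hA
      rw [Matrix.trace_fin_two] at this
      exact eq_neg_of_add_eq_zero_right this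
    have b1 : mat B 1 1 = -mat B 0 0 := by
      have := mem_traceless.1 hB
      rw [Matrix.trace_fin_two] at this
      exact eq_neg_of_add_eq_zero_right this
    have a2 : mat A 1 0 = K.conj (mat A 0 1) := (conj_mat A 1 0).symm
    have b2 : mat B 1 0 = K.conj (mat B 0 1) := (conj_mat B 1 0).symm
    have a0 := mat_zero_zero A
    have b0 := mat_zero_zero B
    generalize K.re (mat A 0 0) = α at a0
    generalize K.re (mat B 0 0) = β at b0
    have h1 := K.mul_conj_add (mat A 0 1) (mat B 0 1)
    have h2 := K.mul_conj_add (K.conj (mat A 0 1)) (K.conj (mat B 0 1))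
    rw [K.conj_conj, K.conj_conj, K.form_conj_conj] at h2
    refine ⟨2 * α * β + 2 * K.form (mat A 0 1) (mat B 0 1), ?_⟩
    ext i j
    rw [mat_mul, map_smul, mat_one]
    fin_cases i <;> fin_cases j <;>
      simp only [Matrix.add_apply, Matrix.mul_apply, Fin.sum_univ_two, Fin.zero_eta, Fin.mk_one,
        Fin.isValue, a1, a2, b1, b2, a0, b0, Matrix.smul_apply, Matrix.one_apply, neg_mul, mul_neg,
        smul_mul_assoc, mul_smul_comm, one_mul, mul_one, neg_neg, smul_neg, if_true, one_ne_zero,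
        zero_ne_one, if_false, smul_zero]
    · rw [add_smul, ← h1]; module
    · abel
    · abel
    · rw [add_smul, ← h2]; module
  rw [form_apply, hc, map_smul, reTr_one, smul_eq_mul]
  congr 1
  ring

theorem one_notMem : (1 : H2 K) ∉ traceless K := by
  rw [mem_traceless_iff, reTr_one]; norm_num

theorem exists_decomp (X : H2 K) : ∃ (t : ℝ) (A : H2 K), A ∈ traceless K ∧ X = t • 1 + A := by
  refine ⟨reTr X / 2, X - (reTr X / 2) • 1, ?_, by abel⟩
  rw [mem_traceless_iff, map_sub, map_smul, reTr_one, smul_eq_mul]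
  ring

/-- The commutator `[R_A, R_B]` of the multiplications by `A` and `B` in `H₂(K)`. -/
def commR (A B : H2 K) : Module.End ℝ (H2 K) :=
  ⁅LinearMap.mulRight ℝ A, LinearMap.mulRight ℝ B⁆

theorem commR_apply (A B X : H2 K) : commR A B X = X * B * A - X * A * B := rfl

theorem commR_one (A B : H2 K) : commR A B 1 = 0 := by
  rw [commR_apply, mul_comm' 1 B, mul_comm' 1 A, mul_one', mul_one', smul_mul_assoc,
    smul_mul_assoc, mul_comm' A B, sub_self]

theorem commR_traceless {A B X : H2 K} (hA : A ∈ traceless K) (hB : B ∈ traceless K)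
    (hX : X ∈ traceless K) : commR A B X = form X B • A - form X A • B := by
  rw [commR_apply, mul_traceless hX hB, mul_traceless hX hA, smul_mul_assoc, smul_mul_assoc,
    mul_comm' 1 A, mul_comm' 1 B, mul_one', mul_one', smul_smul, smul_smul]
  congr 2 <;> ring

theorem commR_mem {A B : H2 K} (hA : A ∈ traceless K) (hB : B ∈ traceless K) :
    commR A B ∈ Der (H2 K) := by
  intro X Y
  obtain ⟨s, X, hX, rfl⟩ := exists_decomp X
  obtain ⟨t, Y, hY, rfl⟩ := exists_decomp Y
  have mem : ∀ {Z : H2 K}, Z ∈ traceless K → commR A B Z ∈ traceless K := by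
    intro Z hZ
    rw [commR_traceless hA hB hZ]
    exact sub_mem (Submodule.smul_mem _ _ hA) (Submodule.smul_mem _ _ hB)
  have skew : form (commR A B X) Y + form X (commR A B Y) = 0 := by
    rw [commR_traceless hA hB hX, commR_traceless hA hB hY]
    simp only [map_sub, map_smul, LinearMap.sub_apply, LinearMap.smul_apply, smul_eq_mul]
    rw [form_comm Y A, form_comm Y B]
    ring
  have hone : ∀ Z : H2 K, 1 * Z = (2 : ℝ) • Z := fun Z => by rw [mul_comm', mul_one']
  simp only [map_add, map_smul, commR_one, smul_zero, zero_add, add_mul, mul_add, smul_mul_assoc,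
    mul_smul_comm, hone, mul_one', mul_traceless hX hY, mul_traceless (mem hX) hY,
    mul_traceless hX (mem hY), add_zero]
  have : form X (commR A B Y) = -form (commR A B X) Y := by linarith
  rw [this]
  module

variable (K)

/-- The bilinear map `A, B ↦ [R_A, R_B] ∈ Der H₂(K)` on traceless matrices. -/
def commDer : traceless K →ₗ[ℝ] traceless K →ₗ[ℝ] Der (H2 K) :=
  LinearMap.mk₂ ℝ (fun A B => ⟨commR (A : H2 K) B, commR_mem A.2 B.2⟩)
    (by intro A A' B; ext1; ext1 X; simp [commR_apply, mul_add, add_mul]; abel)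
    (by intro c A B; ext1; ext1 X; simp [commR_apply, smul_sub, mul_smul_comm, smul_mul_assoc])
    (by intro A B B'; ext1; ext1 X; simp [commR_apply, mul_add, add_mul]; abel)
    (by intro c A B; ext1; ext1 X; simp [commR_apply, smul_sub, mul_smul_comm, smul_mul_assoc])

theorem commDer_apply (A B : traceless K) :
    (commDer K A B : Module.End ℝ (H2 K))
      = ⁅LinearMap.mulRight ℝ (A : H2 K), LinearMap.mulRight ℝ (B : H2 K)⁆ := rfl

/-- The form `⟨A, B⟩ = Re (tr (A · B))` on traceless matrices. -/
def tform : traceless K →ₗ[ℝ] traceless K →ₗ[ℝ] ℝ :=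
  form.domRestrict₁₂ (traceless K) (traceless K)

theorem tform_apply (A B : traceless K) :
    tform K A B = K.re (mat ((A : H2 K) * (B : H2 K))).trace := rfl

variable {K}

theorem der_one {D : Module.End ℝ (H2 K)} (hD : D ∈ Der (H2 K)) : D 1 = 0 := by
  have h := hD 1 1
  rw [mul_comm' 1 (D 1), mul_one', mul_one', map_smul, left_eq_add, smul_eq_zero] at h
  exact h.resolve_left two_ne_zero

/-- Derivations preserve the traceless matrices. -/
theorem der_mem {D : Module.End ℝ (H2 K)} (hD : D ∈ Der (H2 K)) {A : H2 K}
    (hA : A ∈ traceless K) : D A ∈ traceless K := by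
  obtain ⟨t, B, hB, h⟩ := exists_decomp (D A)
  have h1 := hD A A
  rw [mul_traceless hA hA, map_smul, der_one hD, smul_zero, mul_comm' (D A) A, ← two_smul ℝ,
    eq_comm, smul_eq_zero] at h1
  have h2 := h1.resolve_left two_ne_zero
  rw [h, mul_add, mul_smul_comm, mul_one', mul_traceless hA hB, smul_smul] at h2
  have h3 : (form A B / 2) • (1 : H2 K) ∈ traceless K := by
    rw [← eq_neg_of_add_eq_zero_right h2 |>.symm]
    exact neg_mem (Submodule.smul_mem _ _ hA)
  have h4 : form A B / 2 = 0 := by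
    by_contra h0
    exact one_notMem ((Submodule.smul_mem_iff _ h0).1 h3)
  rw [h4, zero_smul, add_zero, smul_eq_zero] at h2
  rcases h2 with h2 | h2
  · have : t = 0 := by linarith
    rw [h, this, zero_smul, zero_add]
    exact hB
  · rw [h2, map_zero]
    exact zero_mem _

/-- The action of a derivation of `H₂(K)` on the traceless matrices. -/
def act (D : Der (H2 K)) : traceless K →ₗ[ℝ] traceless K :=
  (D : Module.End ℝ (H2 K)).restrict fun _ hA => der_mem D.2 hA

theorem act_zero : act (0 : Der (H2 K)) = 0 := rfl

theorem act_apply (D : Der (H2 K)) (A : traceless K) :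
    (act D A : H2 K) = (D : Module.End ℝ (H2 K)) (A : H2 K) := rfl

end H2

/-! ### The magic square algebra `L₂(K₁, K₂)` -/

/-- `L` and `M` are isomorphic: there is a bracket-preserving linear bijection between them. (If `M`
is a Lie algebra, this says in particular that the bracket of `L` satisfies the Lie axioms.) -/
def LieIsomorphic (L M : Type*) [AddCommGroup L] [Module ℝ L] [Bracket L L] [AddCommGroup M]
    [Module ℝ M] [Bracket M M] : Prop :=
  ∃ φ : L ≃ₗ[ℝ] M, ∀ X Y : L, φ ⁅X, Y⁆ = ⁅φ X, φ Y⁆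

variable (K₁ K₂ : CompAlg)

/-- The vector space `L₂(K₁, K₂) = Der H₂(K₁) ∔ (H₂'(K₁) ⊗ K₂') ∔ so(K₂')`. -/
def L2 : Type := Der (H2 K₁) × (H2.traceless K₁ ⊗[ℝ] K₂.im) × K₂.soIm

namespace L2

instance : AddCommGroup (L2 K₁ K₂) :=
  inferInstanceAs (AddCommGroup (Der (H2 K₁) × (H2.traceless K₁ ⊗[ℝ] K₂.im) × K₂.soIm))

instance : Module ℝ (L2 K₁ K₂) :=
  inferInstanceAs (Module ℝ (Der (H2 K₁) × (H2.traceless K₁ ⊗[ℝ] K₂.im) × K₂.soIm))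

/-- `D_{x,y} = 4 S_{x,y} ∈ so(K₂')`. If `K₂` is associative this is the restriction to `K₂'` of
the derivation `z ↦ [[x, y], z]`. -/
def Dmap : K₂.im →ₗ[ℝ] K₂.im →ₗ[ℝ] K₂.soIm := (4 : ℝ) • K₂.S

/-- The bilinear map with `(A ⊗ x, B ⊗ y) ↦ ¼ ⟨A, B⟩ D_{x,y}`. -/
def soPart : (H2.traceless K₁ ⊗[ℝ] K₂.im) →ₗ[ℝ] (H2.traceless K₁ ⊗[ℝ] K₂.im) →ₗ[ℝ] K₂.soIm :=
  (1 / 4 : ℝ) • (TensorProduct.map₂ (H2.tform K₁) (Dmap K₂)).compr₂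
    (TensorProduct.lid ℝ K₂.soIm).toLinearMap

/-- The bilinear map with `(A ⊗ x, B ⊗ y) ↦ -⟨x, y⟩ [R_A, R_B]`. -/
def derPart :
    (H2.traceless K₁ ⊗[ℝ] K₂.im) →ₗ[ℝ] (H2.traceless K₁ ⊗[ℝ] K₂.im) →ₗ[ℝ] Der (H2 K₁) :=
  -(TensorProduct.map₂ (H2.commDer K₁) K₂.imForm).compr₂
    (TensorProduct.rid ℝ (Der (H2 K₁))).toLinearMap

variable {K₁ K₂}

/-- The action of `Der H₂(K₁)` and `so(K₂')` on `H₂'(K₁) ⊗ K₂'`: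
`A ⊗ x ↦ D(A) ⊗ x + A ⊗ E(x)`. -/
def tact (D : Der (H2 K₁)) (E : K₂.soIm) :
    (H2.traceless K₁ ⊗[ℝ] K₂.im) →ₗ[ℝ] (H2.traceless K₁ ⊗[ℝ] K₂.im) :=
  (H2.act D).rTensor K₂.im + (E : Module.End ℝ K₂.im).lTensor (H2.traceless K₁)

/-- The bracket of `L₂(K₁, K₂)`: the bilinear antisymmetric extension of the brackets of
`Der H₂(K₁)` and `so(K₂')` by `[D, E] = 0`, `[D, A ⊗ x] = D(A) ⊗ x`, `[E, A ⊗ x] = A ⊗ E(x)` and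
`[A ⊗ x, B ⊗ y] = ¼ ⟨A, B⟩ D_{x,y} - ⟨x, y⟩ [R_A, R_B]`. -/
instance : Bracket (L2 K₁ K₂) (L2 K₁ K₂) :=
  ⟨fun X Y =>
    (⁅X.1, Y.1⁆ + derPart K₁ K₂ X.2.1 Y.2.1,
      tact X.1 X.2.2 Y.2.1 - tact Y.1 Y.2.2 X.2.1,
      ⁅X.2.2, Y.2.2⁆ + soPart K₁ K₂ X.2.1 Y.2.1)⟩

/-- The inclusion of `Der H₂(K₁)`. -/
def ofDer (D : Der (H2 K₁)) : L2 K₁ K₂ := (D, 0, 0)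

/-- The elements `A ⊗ x`. -/
def tmul (A : H2.traceless K₁) (x : K₂.im) : L2 K₁ K₂ := (0, A ⊗ₜ x, 0)

/-- The inclusion of `so(K₂')`. -/
def ofSo (E : K₂.soIm) : L2 K₁ K₂ := (0, 0, E)

theorem lie_def (X Y : L2 K₁ K₂) :
    ⁅X, Y⁆ = (⁅X.1, Y.1⁆ + derPart K₁ K₂ X.2.1 Y.2.1,
      tact X.1 X.2.2 Y.2.1 - tact Y.1 Y.2.2 X.2.1,
      ⁅X.2.2, Y.2.2⁆ + soPart K₁ K₂ X.2.1 Y.2.1) := rfl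

theorem lie_ofDer_ofDer (D D' : Der (H2 K₁)) :
    ⁅(ofDer D : L2 K₁ K₂), (ofDer D' : L2 K₁ K₂)⁆ = ofDer ⁅D, D'⁆ := by
  rw [lie_def]; simp [ofDer]; rfl

theorem lie_ofSo_ofSo (E E' : K₂.soIm) :
    ⁅(ofSo E : L2 K₁ K₂), (ofSo E' : L2 K₁ K₂)⁆ = ofSo ⁅E, E'⁆ := by
  rw [lie_def]; simp [ofSo]; rfl

theorem lie_ofDer_ofSo (D : Der (H2 K₁)) (E : K₂.soIm) :
    ⁅(ofDer D : L2 K₁ K₂), (ofSo E : L2 K₁ K₂)⁆ = 0 := by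
  rw [lie_def]; simp [ofDer, ofSo]; rfl

theorem lie_ofDer_tmul (D : Der (H2 K₁)) (A : H2.traceless K₁) (x : K₂.im) :
    ⁅(ofDer D : L2 K₁ K₂), tmul A x⁆ = tmul (H2.act D A) x := by
  rw [lie_def]; simp [ofDer, tmul, tact]; rfl

theorem lie_ofSo_tmul (E : K₂.soIm) (A : H2.traceless K₁) (x : K₂.im) :
    ⁅(ofSo E : L2 K₁ K₂), tmul A x⁆ = tmul A ((E : Module.End ℝ K₂.im) x) := by
  rw [lie_def]; simp [ofSo, tmul, tact, H2.act_zero]; rfl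

theorem lie_tmul_tmul (A B : H2.traceless K₁) (x y : K₂.im) :
    ⁅(tmul A x : L2 K₁ K₂), (tmul B y : L2 K₁ K₂)⁆
      = ofSo ((1 / 4 * H2.tform K₁ A B) • Dmap K₂ x y)
        + ofDer (-(K₂.imForm x y • H2.commDer K₁ A B)) := by
  have h : ∀ (D : Der (H2 K₁)) (E : K₂.soIm), (ofSo E + ofDer D : L2 K₁ K₂) = (D, 0, E) := by
    intro D E
    refine Prod.ext ?_ (Prod.ext ?_ ?_)
    · exact zero_add D
    · exact add_zero (0 : H2.traceless K₁ ⊗[ℝ] K₂.im)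
    · exact add_zero E
  rw [h, lie_def]
  simp [tmul, tact, derPart, soPart, H2.act_zero, mul_smul]
  rfl

end L2

end MagicSquare

end

/-! Let V = H₂'(K₁) with the form ⟨A, B⟩ and W = K₂'. The three summands of L₂(K₁, K₂) are the
blocks of the skew maps of the orthogonal sum V ⊕ W. A skew map has diagonal blocks in so(V) and
so(W). Its off-diagonal blocks determine each other, so they amount to one element of Hom(V, W) ≅ V
⊗ W, where a ⊗ x acts by (v, w) ↦ (-⟨x, w⟩ a, ⟨a, v⟩ x).

The block so(V) is Der H₂(K₁), because A · B = (⟨A, B⟩ / 2) 1 for traceless A, B: a derivation kills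
1, so the Leibniz rule on traceless matrices says no more than skewness (`H2.act_mem`,
`H2.act_injective`, `H2.exists_act_eq`). The constants in the bracket of L₂ are those of the
commutators of blocks (`prodMap_lie_offDiag`, `offDiag_tmul_lie_tmul`). Hence `L2.rep` preserves
brackets and is bijective onto so(V ⊕ W), and the Jacobi identity for L₂ need not be checked
separately.

Finally, V ⊕ W is isometric to K₁ ⊕ K₂ (`toSum`): the off-diagonal entry of A gives K₁, and its real
diagonal entry gives the real line missing from K₂'. A basis with diagonal Gram matrix then turns
skew maps into matrices, and the signature of a Cayley–Dickson double follows from that of the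
algebra being doubled. -/

open LinearMap (BilinForm)

/-! ### The skew maps of an orthogonal direct sum -/

namespace LinearMap.BilinForm

variable {V W : Type*} [AddCommGroup V] [Module ℝ V] [AddCommGroup W] [Module ℝ W]

/-- The orthogonal sum of two bilinear forms. -/
def orthSum (b : BilinForm ℝ V) (c : BilinForm ℝ W) : BilinForm ℝ (V × W) :=
  b.compl₁₂ (LinearMap.fst ℝ V W) (LinearMap.fst ℝ V W)
    + c.compl₁₂ (LinearMap.snd ℝ V W) (LinearMap.snd ℝ V W)

theorem orthSum_apply (b : BilinForm ℝ V) (c : BilinForm ℝ W) (u v : V × W) :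
    b.orthSum c u v = b u.1 v.1 + c u.2 v.2 := rfl

/-- The off-diagonal maps of `V × W` that are skew for the orthogonal sum of `b` and `c`: the
tensor `a ⊗ x` acts as `(v, w) ↦ (-c x w • a, b a v • x)`. -/
noncomputable def offDiag (b : BilinForm ℝ V) (c : BilinForm ℝ W) :
    V ⊗[ℝ] W →ₗ[ℝ] Module.End ℝ (V × W) :=
  TensorProduct.lift <| LinearMap.mk₂ ℝ
    (fun a x => (-((c x).smulRight a ∘ₗ LinearMap.snd ℝ V W)).prod
      ((b a).smulRight x ∘ₗ LinearMap.fst ℝ V W))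
    (by intro a a' x; ext v <;> simp [add_smul, add_comm])
    (by intro r a x; ext v <;> simp [mul_smul, smul_comm r])
    (by intro a x x'; ext v <;> simp [add_smul, add_comm])
    (by intro r a x; ext v <;> simp [mul_smul, smul_comm r])

variable {b : BilinForm ℝ V} {c : BilinForm ℝ W}

theorem offDiag_tmul (a : V) (x : W) (u : V × W) :
    offDiag b c (a ⊗ₜ x) u = (-(c x u.2 • a), b a u.1 • x) := rfl

theorem mem_skewAdjointLieSubalgebra {F : Module.End ℝ V} :
    F ∈ skewAdjointLieSubalgebra b ↔ ∀ u v, b (F u) v = -b u (F v) := by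
  have h : F ∈ skewAdjointLieSubalgebra b ↔ ∀ u v, b (F u) v = b u ((-F) v) := by
    change F ∈ b.skewAdjointSubmodule ↔ _
    rw [mem_skewAdjointSubmodule]
    rfl
  simp only [h, LinearMap.neg_apply, map_neg]

theorem offDiag_mem (hb : ∀ u v, b u v = b v u) (hc : ∀ u v, c u v = c v u) (t : V ⊗[ℝ] W) :
    offDiag b c t ∈ skewAdjointLieSubalgebra (b.orthSum c) := by
  induction t with
  | zero => rw [map_zero]; exact zero_mem _
  | add s t hs ht => rw [map_add]; exact add_mem hs ht
  | tmul a x =>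
    rw [mem_skewAdjointLieSubalgebra]
    intro u v
    simp only [offDiag_tmul, orthSum_apply, map_neg, LinearMap.neg_apply, map_smul,
      LinearMap.smul_apply, smul_eq_mul, hb u.1, hc u.2]
    ring

theorem prodMap_mem {D : Module.End ℝ V} {E : Module.End ℝ W}
    (hD : D ∈ skewAdjointLieSubalgebra b) (hE : E ∈ skewAdjointLieSubalgebra c) :
    LinearMap.prodMap D E ∈ skewAdjointLieSubalgebra (b.orthSum c) := by
  rw [mem_skewAdjointLieSubalgebra] at *
  intro u v
  simp only [orthSum_apply, LinearMap.prodMap_apply, hD, hE]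
  ring

/-- In the commutator on a ⊗ x, one product moves the vectors a and x. In the other, skewness
transfers D and E from the argument to the functionals b(a, ·) and c(x, ·). -/
theorem prodMap_lie_offDiag {D : Module.End ℝ V} {E : Module.End ℝ W}
    (hD : D ∈ skewAdjointLieSubalgebra b) (hE : E ∈ skewAdjointLieSubalgebra c) (t : V ⊗[ℝ] W) :
    ⁅LinearMap.prodMap D E, offDiag b c t⁆
      = offDiag b c ((D.rTensor W + E.lTensor V) t) := by
  rw [mem_skewAdjointLieSubalgebra] at hD hE
  induction t with
  | zero => simp
  | add s t hs ht => rw [map_add, lie_add, hs, ht, ← map_add, ← map_add]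
  | tmul a x =>
    rw [LinearMap.add_apply, LinearMap.rTensor_tmul, LinearMap.lTensor_tmul, map_add]
    refine LinearMap.ext fun u => ?_
    simp only [LieRing.of_associative_ring_bracket, LinearMap.sub_apply, Module.End.mul_apply,
      LinearMap.add_apply, offDiag_tmul, LinearMap.prodMap_apply, Prod.mk_sub_mk, Prod.mk_add_mk,
      map_neg, map_smul, hD, hE, neg_smul]
    ext <;> simp
    abel

/-- Each off-diagonal map exchanges the two factors, so the products are block diagonal. Symmetry of
the forms lets the scalars c(x, x') and b(a, a') factor out. This is the model for the bracket of
two tensors in L₂. -/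
theorem offDiag_tmul_lie_tmul (hb : ∀ u v, b u v = b v u) (hc : ∀ u v, c u v = c v u) (a a' : V)
    (x x' : W) :
    ⁅offDiag b c (a ⊗ₜ x), offDiag b c (a' ⊗ₜ x')⁆
      = LinearMap.prodMap (c x x' • ((b a).smulRight a' - (b a').smulRight a))
          (b a a' • ((c x).smulRight x' - (c x').smulRight x)) := by
  refine LinearMap.ext fun u => ?_
  simp only [LieRing.of_associative_ring_bracket, LinearMap.sub_apply, Module.End.mul_apply,
    offDiag_tmul, LinearMap.prodMap_apply, map_neg, map_smul, hb a' a, hc x' x]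
  refine Prod.ext ?_ ?_
  · change _ = c x x' • (b a u.1 • a' - b a' u.1 • a)
    dsimp only [Prod.fst_sub]
    module
  · change _ = b a a' • (c x u.2 • x' - c x' u.2 • x)
    dsimp only [Prod.snd_sub]
    module

/-- The V → W block is the chain V ⊗ W ≅ V* ⊗ W ≅ Hom(V, W), whose first step is the duality given
by b. Only V has to be finite-dimensional. -/
theorem offDiag_snd_inl (hb : b.Nondegenerate) [FiniteDimensional ℝ V] (t : V ⊗[ℝ] W) :
    LinearMap.snd ℝ V W ∘ₗ offDiag b c t ∘ₗ LinearMap.inl ℝ V W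
      = dualTensorHom ℝ V W ((b.toDual hb).toLinearMap.rTensor W t) := by
  induction t with
  | zero => simp
  | add s t hs ht => rw [map_add, LinearMap.add_comp, LinearMap.comp_add, hs, ht, map_add, map_add]
  | tmul a x => ext v; simp [offDiag_tmul, toDual_def]

theorem offDiag_inl_fst (t : V ⊗[ℝ] W) (v : V) : (offDiag b c t (v, 0)).1 = 0 := by
  induction t with
  | zero => simp
  | add s t hs ht => simp [hs, ht]
  | tmul a x => simp [offDiag_tmul]

theorem offDiag_inr_snd (t : V ⊗[ℝ] W) (w : W) : (offDiag b c t (0, w)).2 = 0 := by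
  induction t with
  | zero => simp
  | add s t hs ht => simp [hs, ht]
  | tmul a x => simp [offDiag_tmul]

theorem offDiag_snd_inl_bijective (hb : b.Nondegenerate) [FiniteDimensional ℝ V] :
    Function.Bijective fun t : V ⊗[ℝ] W =>
      LinearMap.snd ℝ V W ∘ₗ offDiag b c t ∘ₗ LinearMap.inl ℝ V W := by
  simp only [offDiag_snd_inl hb]
  exact (dualTensorHomEquiv ℝ V W).bijective.comp ((b.toDual hb).rTensor W).bijective

theorem prodMap_add_offDiag_eq_zero (hb : b.Nondegenerate) [FiniteDimensional ℝ V]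
    {D : Module.End ℝ V} {E : Module.End ℝ W} {t : V ⊗[ℝ] W}
    (h : LinearMap.prodMap D E + offDiag b c t = 0) : D = 0 ∧ t = 0 ∧ E = 0 := by
  refine ⟨?_, ?_, ?_⟩
  · ext v
    have := congrArg Prod.fst (LinearMap.congr_fun h (v, 0))
    simpa [offDiag_inl_fst] using this
  · apply (offDiag_snd_inl_bijective (c := c) hb).1
    ext v
    have := congrArg Prod.snd (LinearMap.congr_fun h (v, 0))
    simpa using this
  · ext w
    have := congrArg Prod.snd (LinearMap.congr_fun h (0, w))
    simpa [offDiag_inr_snd] using this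

/-- The tensor t is chosen to match the V → W block of F, and the diagonal blocks are read off from
F. What remains is the W → V block, which skewness forces. -/
theorem exists_prodMap_add_offDiag (hb : b.Nondegenerate) [FiniteDimensional ℝ V]
    (hbs : ∀ u v, b u v = b v u) (hcs : ∀ u v, c u v = c v u)
    {F : Module.End ℝ (V × W)} (hF : F ∈ skewAdjointLieSubalgebra (b.orthSum c)) :
    ∃ D ∈ skewAdjointLieSubalgebra b, ∃ t, ∃ E ∈ skewAdjointLieSubalgebra c,
      LinearMap.prodMap D E + offDiag b c t = F := by
  obtain ⟨t, ht⟩ := (offDiag_snd_inl_bijective (W := W) (c := c) hb).2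
    (LinearMap.snd ℝ V W ∘ₗ F ∘ₗ LinearMap.inl ℝ V W)
  have ht' : ∀ v, (offDiag b c t (v, 0)).2 = (F (v, 0)).2 := fun v => LinearMap.congr_fun ht v
  rw [mem_skewAdjointLieSubalgebra] at hF
  refine ⟨LinearMap.fst ℝ V W ∘ₗ F ∘ₗ LinearMap.inl ℝ V W, ?_, t,
    LinearMap.snd ℝ V W ∘ₗ F ∘ₗ LinearMap.inr ℝ V W, ?_, ?_⟩
  · rw [mem_skewAdjointLieSubalgebra]
    intro u v
    simpa [orthSum_apply] using hF (u, 0) (v, 0)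
  · rw [mem_skewAdjointLieSubalgebra]
    intro u v
    simpa [orthSum_apply] using hF (0, u) (0, v)
  · have hS := offDiag_mem hbs hcs t
    rw [mem_skewAdjointLieSubalgebra] at hS
    -- Pairing with any v moves both sides, by skewness, to the V → W blocks, which agree;
    -- nondegeneracy of b then concludes.
    have key : ∀ w, (offDiag b c t (0, w)).1 = (F (0, w)).1 := by
      intro w
      rw [← sub_eq_zero]
      refine hb.1 _ fun v => ?_
      have h1 := hS (0, w) (v, 0)
      have h2 := hF (0, w) (v, 0)
      simp only [orthSum_apply, map_zero, LinearMap.zero_apply, zero_add, add_zero, ht'] at h1 h2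
      rw [map_sub, LinearMap.sub_apply, h1, h2, sub_self]
    -- On a vector of one factor, the other diagonal block leaves a term F (0, 0).
    have h0 : F (0, 0) = 0 := map_zero F
    ext v
    · simp [offDiag_inl_fst]
    · simp [ht', h0]
    · simp [key, h0]
    · simp [offDiag_inr_snd]

end LinearMap.BilinForm

/-! ### Derivations of H₂(K) as skew maps of the traceless matrices -/

namespace MagicSquare

open LinearMap.BilinForm

theorem CompAlg.S_coe {K : CompAlg} (x y : K.im) :
    (K.S x y : Module.End ℝ K.im) = (K.imForm x).smulRight y - (K.imForm y).smulRight x := rfl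

namespace H2

variable {K : CompAlg}

theorem tform_comm (A B : traceless K) : tform K A B = tform K B A :=
  form_comm (A : H2 K) B

/-- Since A · B is a multiple of 1 and D kills 1, the Leibniz rule reads 0 = D(A) · B + A · D(B);
its real trace is skewness. -/
theorem act_mem (D : Der (H2 K)) : act D ∈ skewAdjointLieSubalgebra (tform K) := by
  rw [mem_skewAdjointLieSubalgebra]
  intro A B
  have h := congrArg reTr (D.2 (A : H2 K) B)
  rw [mul_traceless A.2 B.2, map_smul, der_one D.2, smul_zero, map_zero, map_add,
    ← form_apply, ← form_apply] at h
  exact eq_neg_of_add_eq_zero_left h.symm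

theorem act_injective : Function.Injective (act (K := K)) := by
  intro D D' h
  refine Subtype.ext (LinearMap.ext fun X => ?_)
  obtain ⟨t, A, hA, rfl⟩ := exists_decomp X
  have h1 : (D : Module.End ℝ (H2 K)) A = (D' : Module.End ℝ (H2 K)) A :=
    congrArg Subtype.val (LinearMap.congr_fun h ⟨A, hA⟩)
  rw [map_add, map_add, map_smul, map_smul, der_one D.2, der_one D'.2, h1]

/-- Extended by 0 on the identity matrix, F is a derivation: on two traceless matrices the Leibniz
rule is skewness, and products with 1 are immediate. -/
theorem exists_act_eq {F : Module.End ℝ (traceless K)}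
    (hF : F ∈ skewAdjointLieSubalgebra (tform K)) : ∃ D : Der (H2 K), act D = F := by
  rw [mem_skewAdjointLieSubalgebra] at hF
  -- The projection along the identity matrix; the factor 1 / 2 comes from Re tr 1 = 2.
  let P : H2 K →ₗ[ℝ] traceless K :=
    (LinearMap.id - ((1 / 2 : ℝ) • reTr).smulRight (1 : H2 K)).codRestrict (traceless K) (by
      intro X
      rw [mem_traceless_iff]
      simp only [LinearMap.sub_apply, LinearMap.id_apply, LinearMap.smulRight_apply,
        LinearMap.smul_apply, smul_eq_mul, map_sub, map_smul, reTr_one]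
      ring)
  have P_one : P 1 = 0 := by
    ext1
    simp [P, reTr_one]
  have P_coe : ∀ A : traceless K, P A = A := by
    intro A
    ext1
    simp [P, mem_traceless_iff.1 A.2]
  let G : Module.End ℝ (H2 K) := (traceless K).subtype ∘ₗ F ∘ₗ P
  have G_one : G 1 = 0 := by simp [G, P_one]
  have G_coe : ∀ A : traceless K, G A = F A := fun A => by simp [G, P_coe]
  have hG : G ∈ Der (H2 K) := by
    intro X Y
    obtain ⟨s, X, hX, rfl⟩ := exists_decomp X
    obtain ⟨t, Y, hY, rfl⟩ := exists_decomp Y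
    lift X to traceless K using hX
    lift Y to traceless K using hY
    have skew : form (X : H2 K) (F Y : H2 K) = -form (F X : H2 K) (Y : H2 K) := by
      exact (neg_eq_iff_eq_neg.2 (hF X Y)).symm
    have hone : ∀ Z : H2 K, 1 * Z = (2 : ℝ) • Z := fun Z => by rw [mul_comm', mul_one']
    simp only [map_add, map_smul, G_one, G_coe, smul_zero, zero_add, add_mul, mul_add,
      smul_mul_assoc, mul_smul_comm, hone, mul_one', mul_traceless X.2 Y.2,
      mul_traceless (F X).2 Y.2, mul_traceless X.2 (F Y).2, add_zero, skew]
    module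
  exact ⟨⟨G, hG⟩, LinearMap.ext fun A => Subtype.ext (G_coe A)⟩

/-- The orientation is opposite to that of `CompAlg.S`, which accounts for the minus sign before ⟨x,
y⟩ [R_A, R_B] in the bracket. -/
theorem act_commDer (A B : traceless K) :
    act (commDer K A B) = (tform K B).smulRight A - (tform K A).smulRight B := by
  ext1 X
  apply Subtype.ext
  refine (commR_traceless A.2 B.2 X.2).trans ?_
  rw [form_comm (X : H2 K) B, form_comm (X : H2 K) A]
  rfl

theorem act_lie (D D' : Der (H2 K)) : act ⁅D, D'⁆ = ⁅act D, act D'⁆ := rfl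

/-- The linear map `act`. -/
def actₗ : Der (H2 K) →ₗ[ℝ] Module.End ℝ (traceless K) where
  toFun := act
  map_add' _ _ := rfl
  map_smul' _ _ := rfl

theorem actₗ_apply (D : Der (H2 K)) : actₗ D = act D := rfl

end H2

/-! ### The representation of L₂(K₁, K₂) by skew maps -/

namespace L2

variable {K₁ K₂ : CompAlg}

/-- `L₂(K₁, K₂)` acting on `H₂'(K₁) ∔ K₂'`. -/
noncomputable def rep : L2 K₁ K₂ →ₗ[ℝ] Module.End ℝ (H2.traceless K₁ × K₂.im) where
  toFun X := LinearMap.prodMap (H2.actₗ X.1) (X.2.2 : Module.End ℝ K₂.im)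
    + offDiag (H2.tform K₁) K₂.imForm X.2.1
  map_add' X Y := by
    change LinearMap.prodMap (H2.actₗ (X.1 + Y.1)) ((X.2.2 + Y.2.2 : K₂.soIm) : Module.End ℝ K₂.im)
      + offDiag (H2.tform K₁) K₂.imForm (X.2.1 + Y.2.1) = _
    rw [map_add, map_add, AddMemClass.coe_add, LinearMap.prodMap_add]
    exact add_add_add_comm _ _ _ _
  map_smul' r X := by
    change LinearMap.prodMap (H2.actₗ (r • X.1)) ((r • X.2.2 : K₂.soIm) : Module.End ℝ K₂.im)
      + offDiag (H2.tform K₁) K₂.imForm (r • X.2.1) = _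
    rw [map_smul, map_smul, SetLike.val_smul, LinearMap.prodMap_smul, ← smul_add]
    rfl

theorem rep_mem (X : L2 K₁ K₂) :
    rep X ∈ skewAdjointLieSubalgebra (orthSum (H2.tform K₁) K₂.imForm) :=
  add_mem (prodMap_mem (H2.act_mem X.1) X.2.2.2)
    (offDiag_mem H2.tform_comm K₂.imForm_comm X.2.1)

theorem actₗ_derPart_tmul (A B : H2.traceless K₁) (x y : K₂.im) :
    H2.actₗ (derPart K₁ K₂ (A ⊗ₜ x) (B ⊗ₜ y))
      = K₂.imForm x y • ((H2.tform K₁ A).smulRight B - (H2.tform K₁ B).smulRight A) := by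
  have h : derPart K₁ K₂ (A ⊗ₜ x) (B ⊗ₜ y) = K₂.imForm x y • -H2.commDer K₁ A B := by
    simp [derPart]
  have h' : -H2.actₗ (H2.commDer K₁ A B)
      = (H2.tform K₁ A).smulRight B - (H2.tform K₁ B).smulRight A := by
    rw [H2.actₗ_apply, H2.act_commDer, neg_sub]
  rw [h, ← h']
  rfl

/-- The factor ¼ in the bracket cancels the 4 in D_{x,y} = 4 S_{x,y}. -/
theorem soPart_tmul (A B : H2.traceless K₁) (x y : K₂.im) :
    (soPart K₁ K₂ (A ⊗ₜ x) (B ⊗ₜ y) : Module.End ℝ K₂.im)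
      = H2.tform K₁ A B • ((K₂.imForm x).smulRight y - (K₂.imForm y).smulRight x) := by
  have h : soPart K₁ K₂ (A ⊗ₜ x) (B ⊗ₜ y) = H2.tform K₁ A B • K₂.S x y := by
    simp [soPart, Dmap, smul_smul]
  rw [h, ← CompAlg.S_coe]
  rfl

/-- Both sides are bilinear, so pure tensors suffice, and there `offDiag_tmul_lie_tmul` gives the
two components with the right constants. -/
theorem offDiag_lie_offDiag (s t : H2.traceless K₁ ⊗[ℝ] K₂.im) :
    ⁅offDiag (H2.tform K₁) K₂.imForm s, offDiag (H2.tform K₁) K₂.imForm t⁆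
      = LinearMap.prodMap (H2.actₗ (derPart K₁ K₂ s t))
          (soPart K₁ K₂ s t : Module.End ℝ K₂.im) := by
  induction s with
  | zero => simp
  | add s s' hs hs' =>
    rw [map_add, add_lie, hs, hs', map_add, map_add, LinearMap.add_apply, LinearMap.add_apply,
      map_add, AddMemClass.coe_add, ← LinearMap.prodMap_add]
  | tmul A x =>
    induction t with
    | zero => simp
    | add t t' ht ht' =>
      rw [map_add, lie_add, ht, ht', map_add, map_add, map_add, AddMemClass.coe_add,
        ← LinearMap.prodMap_add]
    | tmul B y =>
      rw [offDiag_tmul_lie_tmul H2.tform_comm K₂.imForm_comm]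
      rw [actₗ_derPart_tmul, soPart_tmul]

theorem rep_lie (X Y : L2 K₁ K₂) : rep ⁅X, Y⁆ = ⁅rep X, rep Y⁆ := by
  obtain ⟨D, s, E⟩ := X
  obtain ⟨D', t, E'⟩ := Y
  have h : ∀ (D D' : Module.End ℝ (H2.traceless K₁)) (E E' : Module.End ℝ K₂.im),
      ⁅LinearMap.prodMap D E, LinearMap.prodMap D' E'⁆ = LinearMap.prodMap ⁅D, D'⁆ ⁅E, E'⁆ :=
    fun _ _ _ _ => rfl
  change LinearMap.prodMap (H2.act (⁅D, D'⁆ + derPart K₁ K₂ s t))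
      ((⁅E, E'⁆ + soPart K₁ K₂ s t : K₂.soIm) : Module.End ℝ K₂.im)
      + offDiag (H2.tform K₁) K₂.imForm (tact D E t - tact D' E' s)
    = ⁅LinearMap.prodMap (H2.act D) (E : Module.End ℝ K₂.im)
        + offDiag (H2.tform K₁) K₂.imForm s,
      LinearMap.prodMap (H2.act D') (E' : Module.End ℝ K₂.im)
        + offDiag (H2.tform K₁) K₂.imForm t⁆
  simp only [← H2.actₗ_apply, map_add, map_sub, AddMemClass.coe_add, LinearMap.prodMap_add,
    lie_add, add_lie, h, ← offDiag_lie_offDiag, LieSubalgebra.coe_bracket]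
  -- This mixed bracket has its off-diagonal factor first; reversing it makes `prodMap_lie_offDiag`
  -- applicable and produces the minus sign of the tensor component.
  rw [← lie_skew (offDiag _ _ s) (LinearMap.prodMap (H2.actₗ D') (E' : Module.End ℝ K₂.im))]
  simp only [H2.actₗ_apply, H2.act_lie]
  rw [prodMap_lie_offDiag (H2.act_mem D) E.2, prodMap_lie_offDiag (H2.act_mem D') E'.2]
  simp only [tact]
  abel

theorem rep_bijective [FiniteDimensional ℝ (H2.traceless K₁)]
    (h : (H2.tform K₁ : BilinForm ℝ (H2.traceless K₁)).Nondegenerate) :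
    Function.Bijective fun X : L2 K₁ K₂ =>
      (⟨rep X, rep_mem X⟩ : skewAdjointLieSubalgebra (orthSum (H2.tform K₁) K₂.imForm)) := by
  constructor
  · intro X Y hXY
    have h1 : rep (X - Y) = 0 := by rw [map_sub, sub_eq_zero]; exact congrArg Subtype.val hXY
    obtain ⟨h2, h3, h4⟩ := prodMap_add_offDiag_eq_zero h h1
    rw [← sub_eq_zero]
    exact Prod.ext (H2.act_injective h2) (Prod.ext h3 (Subtype.ext h4))
  · rintro ⟨F, hF⟩
    obtain ⟨D, hD, t, E, hE, rfl⟩ :=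
      exists_prodMap_add_offDiag h H2.tform_comm K₂.imForm_comm hF
    obtain ⟨D, rfl⟩ := H2.exists_act_eq hD
    exact ⟨(D, t, ⟨E, hE⟩), rfl⟩

end L2

/-! ### The isometry of H₂'(K₁) ∔ K₂' with K₁ ∔ K₂ -/

variable {K K₁ K₂ : CompAlg}

namespace CompAlg

theorem associated_sumN (u v : K₁ × K₂) :
    QuadraticMap.associated (sumN K₁ K₂) u v = K₁.form u.1 v.1 + K₂.form u.2 v.2 := by
  simp only [QuadraticMap.associated_apply, sumN, QuadraticMap.prod_apply, form_eq, Prod.fst_add,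
    Prod.snd_add]
  simp
  ring

theorem re_smul_one (r : ℝ) : K.re (r • 1) = r := by
  rw [map_smul, re_one, smul_eq_mul, mul_one]

end CompAlg

namespace H2

/-- Compare the upper left entries in A · B = (⟨A, B⟩ / 2) 1: with diagonal entries α, β and
off-diagonal entries a, b, the left side is 2αβ + a b̄ + b ā = 2αβ + 2⟨a, b⟩. -/
theorem tform_eq (A B : traceless K) :
    tform K A B = 4 * (K.re (mat (A : H2 K) 0 0) * K.re (mat (B : H2 K) 0 0))
      + 4 * K.form (mat (A : H2 K) 0 1) (mat (B : H2 K) 0 1) := by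
  have h := congrArg (fun X : H2 K => K.re (mat X 0 0)) (mul_traceless A.2 B.2)
  have hA : mat (A : H2 K) 1 0 = K.conj (mat (A : H2 K) 0 1) := (conj_mat _ 1 0).symm
  have hB : mat (B : H2 K) 1 0 = K.conj (mat (B : H2 K) 0 1) := (conj_mat _ 1 0).symm
  have h1 := congrArg K.re (K.mul_conj_add (mat (A : H2 K) 0 1) (mat (B : H2 K) 0 1))
  rw [map_add, K.re_smul_one] at h1
  have h2 : K.re (mat (A : H2 K) 0 0 * mat (B : H2 K) 0 0)
      = K.re (mat (A : H2 K) 0 0) * K.re (mat (B : H2 K) 0 0) := by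
    conv_lhs => rw [mat_zero_zero (A : H2 K), mat_zero_zero (B : H2 K)]
    rw [smul_mul_assoc, one_mul, map_smul, K.re_smul_one, smul_eq_mul]
  have h3 : K.re (mat (B : H2 K) 0 0 * mat (A : H2 K) 0 0)
      = K.re (mat (A : H2 K) 0 0) * K.re (mat (B : H2 K) 0 0) := by
    conv_lhs => rw [mat_zero_zero (A : H2 K), mat_zero_zero (B : H2 K)]
    rw [smul_mul_assoc, one_mul, map_smul, K.re_smul_one, smul_eq_mul, mul_comm]
  simp only [mat_mul, map_smul, mat_one, Matrix.add_apply, Matrix.mul_apply, Fin.sum_univ_two, hA,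
    hB, Matrix.smul_apply, Matrix.one_apply_eq, map_add, K.re_one, smul_eq_mul, mul_one, h2, h3] at h
  change form (A : H2 K) B = _
  linarith

/-- The traceless hermitian matrix with given first row. -/
noncomputable def mkTraceless (t : ℝ) (x : K) : traceless K :=
  ⟨(⟨!![t • 1, x; K.conj x, -(t • 1)], by
    intro i j
    fin_cases i <;> fin_cases j <;> simp [K.conj_conj, K.conj_one]⟩ : herm K), by
    change Matrix.trace !![t • 1, x; K.conj x, -(t • 1)] = 0
    simp [Matrix.trace_fin_two]⟩

theorem mat_mkTraceless (t : ℝ) (x : K) :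
    mat (mkTraceless t x : H2 K) = !![t • 1, x; K.conj x, -(t • 1)] := rfl

end H2

/-- The linear map `H₂'(K₁) ∔ K₂' → K₁ ∔ K₂`, which is isometric. -/
noncomputable def toSum (K₁ K₂ : CompAlg) : H2.traceless K₁ × K₂.im →ₗ[ℝ] K₁ × K₂ where
  toFun u := ((2 : ℝ) • H2.mat (u.1 : H2 K₁) 0 1,
    (2 * K₁.re (H2.mat (u.1 : H2 K₁) 0 0)) • 1 + (u.2 : K₂))
  map_add' u v := by
    ext
    · simp
    · simp [mul_add, add_smul]; abel
  map_smul' r u := by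
    ext
    · simp [smul_comm r]
    · simp [smul_smul, mul_left_comm]

theorem toSum_apply (u : H2.traceless K₁ × K₂.im) :
    toSum K₁ K₂ u = ((2 : ℝ) • H2.mat (u.1 : H2 K₁) 0 1,
      (2 * K₁.re (H2.mat (u.1 : H2 K₁) 0 0)) • 1 + (u.2 : K₂)) := rfl

/-- The factors 2 in `toSum` absorb the 4 of `H2.tform_eq`, and the cross terms vanish because K₂'
is orthogonal to 1. -/
theorem associated_toSum (u v : H2.traceless K₁ × K₂.im) :
    QuadraticMap.associated (CompAlg.sumN K₁ K₂) (toSum K₁ K₂ u) (toSum K₁ K₂ v)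
      = orthSum (H2.tform K₁) K₂.imForm u v := by
  have h1 : ∀ w : K₂.im, K₂.form 1 w = 0 := fun w => w.2
  have h2 : K₂.form 1 1 = 1 := K₂.re_one
  rw [CompAlg.associated_sumN, orthSum_apply, H2.tform_eq, toSum_apply, toSum_apply,
    CompAlg.imForm_apply]
  simp only [map_add, map_smul, LinearMap.add_apply, LinearMap.smul_apply, smul_eq_mul, h1, h2,
    K₂.form_comm _ 1]
  ring

theorem toSum_bijective : Function.Bijective (toSum K₁ K₂) := by
  constructor
  · rw [injective_iff_map_eq_zero]
    rintro ⟨A, w⟩ h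
    rw [toSum_apply, Prod.mk_eq_zero] at h
    obtain ⟨h1, h2⟩ := h
    -- The real part separates the diagonal entry of A from the imaginary w.
    have h3 := congrArg K₂.re h2
    rw [map_add, K₂.re_smul_one, map_zero, LinearMap.mem_ker.1 w.2, add_zero] at h3
    rw [h3, zero_smul, zero_add] at h2
    have h01 := (smul_eq_zero.1 h1).resolve_left two_ne_zero
    have h00 : H2.mat (A : H2 K₁) 0 0 = 0 := by
      rw [H2.mat_zero_zero, (mul_eq_zero.1 h3).resolve_left two_ne_zero, zero_smul]
    have h11 : H2.mat (A : H2 K₁) 1 1 = 0 := by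
      simpa [Matrix.trace_fin_two, h00] using H2.mem_traceless.1 A.2
    have h10 : H2.mat (A : H2 K₁) 1 0 = 0 := by rw [← H2.conj_mat, h01, map_zero]
    refine Prod.ext (Subtype.ext (H2.ext ?_)) (Subtype.ext h2)
    ext i j
    fin_cases i <;> fin_cases j <;> simp [h00, h01, h10, h11]
  · rintro ⟨x, y⟩
    refine ⟨(H2.mkTraceless (K₂.re y / 2) ((1 / 2 : ℝ) • x), ⟨y - K₂.re y • 1, ?_⟩), ?_⟩
    · rw [CompAlg.im, LinearMap.mem_ker, map_sub, K₂.re_smul_one, sub_self]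
    · rw [toSum_apply, H2.mat_mkTraceless]
      ext
      · simp
      · simp [K₁.re_one, mul_div_cancel₀]

/-- H₂'(K) is an orthogonal summand of a space isometric to K ∔ K, whose form is nondegenerate. The
second copy of K is an auxiliary choice. -/
theorem tform_nondegenerate : (H2.tform K : BilinForm ℝ (H2.traceless K)).Nondegenerate := by
  have h : ∀ A, (∀ B, H2.tform K A B = 0) → A = 0 := by
    intro A hA
    have h0 : ∀ v : K × K, QuadraticMap.associated (CompAlg.sumN K K) (toSum K K (A, 0)) v = 0 := by
      intro v
      obtain ⟨⟨B, w⟩, rfl⟩ := toSum_bijective (K₁ := K) (K₂ := K) |>.2 v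
      simp [associated_toSum, orthSum_apply, hA]
    have h1 : toSum K K (A, 0) = 0 := by
      ext1
      · refine K.nondegenerate _ fun y => (?_ : K.form _ y = 0)
        simpa [CompAlg.associated_sumN] using h0 (y, 0)
      · refine K.nondegenerate _ fun y => (?_ : K.form _ y = 0)
        simpa [CompAlg.associated_sumN] using h0 (0, y)
    exact congrArg Prod.fst ((injective_iff_map_eq_zero _).1 toSum_bijective.1 _ h1)
  exact ⟨h, fun A hA => h A fun B => by rw [H2.tform_comm, hA]⟩

theorem LieIsomorphic.trans_lieEquiv {L M N : Type*} [AddCommGroup L] [Module ℝ L] [Bracket L L]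
    [LieRing M] [LieAlgebra ℝ M] [LieRing N] [LieAlgebra ℝ N] (h : LieIsomorphic L M)
    (e : M ≃ₗ⁅ℝ⁆ N) : LieIsomorphic L N := by
  obtain ⟨φ, hφ⟩ := h
  refine ⟨φ.trans e.toLinearEquiv, fun X Y => ?_⟩
  simp only [LinearEquiv.trans_apply, hφ]
  exact e.map_lie _ _

/-- `L₂(K₁, K₂) ≅ so(K₁ ∔ K₂)` for finite-dimensional composition algebras. -/
theorem lieIsomorphic_soSum (K₁ K₂ : CompAlg) [FiniteDimensional ℝ K₁] :
    LieIsomorphic (L2 K₁ K₂) (CompAlg.soSum K₁ K₂) := by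
  have : FiniteDimensional ℝ (H2 K₁) := inferInstanceAs (FiniteDimensional ℝ (herm K₁))
  let e : (H2.traceless K₁ × K₂.im) ≃ₗ[ℝ] K₁ × K₂ := LinearEquiv.ofBijective _ toSum_bijective
  -- The isometry stated as a pullback of forms, so that conjugation by e identifies the two
  -- algebras of skew maps.
  have he : (QuadraticMap.associated (CompAlg.sumN K₁ K₂) : BilinForm ℝ (K₁ × K₂)).compl₁₂
      (e : (H2.traceless K₁ × K₂.im) →ₗ[ℝ] K₁ × K₂)
      (e : (H2.traceless K₁ × K₂.im) →ₗ[ℝ] K₁ × K₂) = orthSum (H2.tform K₁) K₂.imForm :=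
    LinearMap.ext₂ associated_toSum
  have h : LieIsomorphic (L2 K₁ K₂) (skewAdjointLieSubalgebra (orthSum (H2.tform K₁) K₂.imForm)) :=
    ⟨LinearEquiv.ofBijective (LinearMap.codRestrict
        (skewAdjointLieSubalgebra (orthSum (H2.tform K₁) K₂.imForm)).toSubmodule
        L2.rep L2.rep_mem) (L2.rep_bijective tform_nondegenerate),
      fun X Y => Subtype.ext (L2.rep_lie X Y)⟩
  rw [← he] at h
  exact h.trans_lieEquiv (skewAdjointLieSubalgebraEquiv _ e)

end MagicSquare

/-! ### Matrices -/

namespace LinearMap.BilinForm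

variable {V ι : Type*} [AddCommGroup V] [Module ℝ V] [Fintype ι] [DecidableEq ι]

/-- In a basis, the skew maps of a bilinear form are the skew-adjoint matrices of its Gram matrix. -/
theorem exists_lieEquiv_matrix (B : BilinForm ℝ V) (b : Module.Basis ι ℝ V) {J : Matrix ι ι ℝ}
    (hJ : ∀ i j, B (b i) (b j) = J i j) :
    Nonempty (skewAdjointLieSubalgebra B ≃ₗ⁅ℝ⁆ skewAdjointMatricesLieSubalgebra J) := by
  have hB : B = Matrix.toLinearMap₂ b b J := by
    refine b.ext fun i => b.ext fun j => ?_
    rw [hJ, Matrix.toLinearMap₂_apply_basis]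
  refine ⟨LieEquiv.ofSubalgebras _ _ (LinearMap.toMatrixAlgEquiv b).toLieEquiv ?_⟩
  ext A
  rw [LieSubalgebra.mem_map]
  have key : ∀ F : Module.End ℝ V, F ∈ skewAdjointLieSubalgebra B ↔
      LinearMap.toMatrixAlgEquiv b F ∈ skewAdjointMatricesLieSubalgebra J := by
    intro F
    rw [mem_skewAdjointMatricesLieSubalgebra, mem_skewAdjointMatricesSubmodule,
      Matrix.IsSkewAdjoint, ← isAdjointPair_toLinearMap₂ b b, ← hB]
    change F ∈ B.skewAdjointSubmodule ↔ _
    rw [mem_skewAdjointSubmodule, map_neg]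
    have h : Matrix.toLin b b (LinearMap.toMatrixAlgEquiv b F) = F :=
      Matrix.toLin_toMatrix b b F
    rw [h]
    rfl
  constructor
  · rintro ⟨F, hF, rfl⟩
    exact (key F).1 hF
  · intro hA
    refine ⟨(LinearMap.toMatrixAlgEquiv b).symm A, (key _).2 ?_, ?_⟩
    · rwa [AlgEquiv.apply_symm_apply]
    · exact AlgEquiv.apply_symm_apply _ A

/-- `B` has an orthogonal basis of `p` vectors of square `1` and `q` vectors of square `-1`. -/
def HasSignature (B : BilinForm ℝ V) (p q : ℕ) : Prop :=
  ∃ b : Module.Basis (Fin p ⊕ Fin q) ℝ V,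
    ∀ i j, B (b i) (b j) = LieAlgebra.Orthogonal.indefiniteDiagonal (Fin p) (Fin q) ℝ i j

namespace HasSignature

variable {W : Type*} [AddCommGroup W] [Module ℝ W] {B : BilinForm ℝ V} {C : BilinForm ℝ W}
  {p q p' q' : ℕ}

theorem finrank (h : HasSignature B p q) : Module.finrank ℝ V = p + q := by
  obtain ⟨b, -⟩ := h
  rw [Module.finrank_eq_card_basis b, Fintype.card_sum, Fintype.card_fin, Fintype.card_fin]

theorem finiteDimensional (h : HasSignature B p q) : FiniteDimensional ℝ V := by
  obtain ⟨b, -⟩ := h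
  exact Module.Finite.of_basis b

theorem neg (h : HasSignature B p q) : HasSignature (-B) q p := by
  obtain ⟨b, hb⟩ := h
  refine ⟨b.reindex (Equiv.sumComm _ _), fun i j => ?_⟩
  rcases i with i | i <;> rcases j with j | j <;>
    simp [hb, LieAlgebra.Orthogonal.indefiniteDiagonal, Matrix.diagonal_apply] <;>
    split_ifs <;> simp

theorem orthSum (h : HasSignature B p q) (h' : HasSignature C p' q') :
    HasSignature (B.orthSum C) (p + p') (q + q') := by
  obtain ⟨b, hb⟩ := h
  obtain ⟨c, hc⟩ := h'
  -- The middle blocks are exchanged, so that all vectors of square 1 precede all vectors of square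
  -- -1.
  let f : (Fin p ⊕ Fin q) ⊕ (Fin p' ⊕ Fin q') ≃ Fin (p + p') ⊕ Fin (q + q') :=
    (Equiv.sumSumSumComm _ _ _ _).trans (Equiv.sumCongr finSumFinEquiv finSumFinEquiv)
  refine ⟨(b.prod c).reindex f, fun i j => ?_⟩
  obtain ⟨i, rfl⟩ := f.surjective i
  obtain ⟨j, rfl⟩ := f.surjective j
  rw [Module.Basis.reindex_apply, Module.Basis.reindex_apply, Equiv.symm_apply_apply,
    Equiv.symm_apply_apply, orthSum_apply, LieAlgebra.Orthogonal.indefiniteDiagonal,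
    Matrix.diagonal_apply]
  simp only [f.injective.eq_iff]
  rcases i with (i | i) | (i | i) <;> rcases j with (j | j) | (j | j) <;>
    simp [f, hb, hc, LieAlgebra.Orthogonal.indefiniteDiagonal, Matrix.diagonal_apply]

theorem exists_lieEquiv_so' (h : HasSignature B p q) :
    Nonempty (skewAdjointLieSubalgebra B ≃ₗ⁅ℝ⁆
      LieAlgebra.Orthogonal.so' (Fin p) (Fin q) ℝ) := by
  obtain ⟨b, hb⟩ := h
  exact exists_lieEquiv_matrix B b hb

theorem exists_lieEquiv_so (h : HasSignature B p 0) :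
    Nonempty (skewAdjointLieSubalgebra B ≃ₗ⁅ℝ⁆ LieAlgebra.Orthogonal.so (Fin p) ℝ) := by
  obtain ⟨b, hb⟩ := h
  refine exists_lieEquiv_matrix B (b.reindex (Equiv.sumEmpty _ _)) fun i j => ?_
  simp [hb, LieAlgebra.Orthogonal.indefiniteDiagonal, Matrix.diagonal_apply, Matrix.one_apply]

end HasSignature

theorem hasSignature_innerₗ (E : Type*) [NormedAddCommGroup E] [InnerProductSpace ℝ E]
    [FiniteDimensional ℝ E] : HasSignature (innerₗ E) (Module.finrank ℝ E) 0 := by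
  refine ⟨(stdOrthonormalBasis ℝ E).toBasis.reindex (Equiv.sumEmpty _ _).symm, ?_⟩
  rintro (i | i) (j | j)
  · simp [LieAlgebra.Orthogonal.indefiniteDiagonal, Matrix.diagonal_apply,
      (stdOrthonormalBasis ℝ E).inner_eq_ite]
  all_goals exact Fin.elim0 ‹_›

end LinearMap.BilinForm

/-! ### Signatures of the composition algebras -/

namespace MagicSquare

open LinearMap.BilinForm

namespace CompAlg

theorem associated_innerₗ (E : Type*) [NormedAddCommGroup E] [InnerProductSpace ℝ E] :
    QuadraticMap.associated (LinearMap.BilinMap.toQuadraticMap (innerₗ E)) = innerₗ E := by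
  ext x y
  simp [QuadraticMap.associated_apply, real_inner_comm x y, inner_add_right]
  ring

theorem R_hasSignature : HasSignature R.form 1 0 := by
  have h := hasSignature_innerₗ ℝ
  rwa [Module.finrank_self, ← associated_innerₗ] at h

theorem C_hasSignature : HasSignature C.form 2 0 := by
  have h := hasSignature_innerₗ ℂ
  rwa [Complex.finrank_real_complex, ← associated_innerₗ] at h

theorem H_hasSignature : HasSignature H.form 4 0 := by
  have h := hasSignature_innerₗ ℍ[ℝ]
  rwa [Quaternion.finrank_eq_four, ← associated_innerₗ] at h

theorem double_form_neg_one (K : CompAlg) (h₀ : (-1 : ℝ) ≠ 0)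
    (assoc : ∀ x y z : K, x * y * z = x * (y * z)) :
    (K.double (-1) h₀ assoc).form = (orthSum K.form K.form : BilinForm ℝ (K × K)) := by
  refine LinearMap.ext₂ fun (u v : Double K (-1)) => ?_
  refine ((K.double (-1) h₀ assoc).form_eq u v).trans ?_
  change (Double.N K (-1) (u + v) - Double.N K (-1) u - Double.N K (-1) v) / 2
    = K.form u.1 v.1 + K.form u.2 v.2
  simp only [form_eq, Double.N_apply, Double.add_fst, Double.add_snd]
  ring

/-- From |(a, b)|² = |a|² - |b|²: the second copy of K enters negated, so a definite K gives a
neutral double. -/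
theorem double_form_one (K : CompAlg) (h₀ : (1 : ℝ) ≠ 0)
    (assoc : ∀ x y z : K, x * y * z = x * (y * z)) :
    (K.double 1 h₀ assoc).form = (orthSum K.form (-K.form) : BilinForm ℝ (K × K)) := by
  refine LinearMap.ext₂ fun (u v : Double K 1) => ?_
  refine ((K.double 1 h₀ assoc).form_eq u v).trans ?_
  change (Double.N K 1 (u + v) - Double.N K 1 u - Double.N K 1 v) / 2
    = K.form u.1 v.1 + -K.form u.2 v.2
  simp only [form_eq, Double.N_apply, Double.add_fst, Double.add_snd]
  ring

theorem O_hasSignature : HasSignature O.form 8 0 := by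
  have h := H_hasSignature.orthSum H_hasSignature
  rw [← double_form_neg_one H (by norm_num) (mul_assoc (G := ℍ[ℝ]))] at h
  exact h

theorem splitC_hasSignature : HasSignature splitC.form 1 1 := by
  have h := R_hasSignature.orthSum R_hasSignature.neg
  rw [← double_form_one R one_ne_zero (mul_assoc (G := ℝ))] at h
  exact h

theorem splitH_hasSignature : HasSignature splitH.form 2 2 := by
  have h := C_hasSignature.orthSum C_hasSignature.neg
  rw [← double_form_one C one_ne_zero (mul_assoc (G := ℂ))] at h
  exact h

theorem splitO_hasSignature : HasSignature splitO.form 4 4 := by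
  have h := H_hasSignature.orthSum H_hasSignature.neg
  rw [← double_form_one H one_ne_zero (mul_assoc (G := ℍ[ℝ]))] at h
  exact h

theorem hasSignature_sumN {K₁ K₂ : CompAlg} {p q p' q' : ℕ} (h : HasSignature K₁.form p q)
    (h' : HasSignature K₂.form p' q') :
    HasSignature (QuadraticMap.associated (sumN K₁ K₂)) (p + p') (q + q') := by
  have e : QuadraticMap.associated (sumN K₁ K₂) = LinearMap.BilinForm.orthSum K₁.form K₂.form :=
    LinearMap.ext₂ associated_sumN
  rw [e]
  exact h.orthSum h'

theorem hasSignature_dim {K : CompAlg} (hK : K ∈ ({.R, .C, .H, .O} : Set CompAlg)) :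
    HasSignature K.form K.dim 0 := by
  have key : ∀ {K : CompAlg} {p : ℕ}, HasSignature K.form p 0 → HasSignature K.form K.dim 0 :=
    fun h => by rwa [dim, h.finrank]
  rcases hK with rfl | rfl | rfl | rfl
  exacts [key R_hasSignature, key C_hasSignature, key H_hasSignature, key O_hasSignature]

theorem hasSignature_half_dim {K : CompAlg}
    (hK : K ∈ ({.splitC, .splitH, .splitO} : Set CompAlg)) :
    HasSignature K.form (K.dim / 2) (K.dim / 2) := by
  have key : ∀ {K : CompAlg} {p : ℕ}, HasSignature K.form p p →
      HasSignature K.form (K.dim / 2) (K.dim / 2) := fun {K p} h => by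
    -- Here dim K = p + p, so the natural-number division is exact.
    have : K.dim / 2 = p := by rw [dim, h.finrank]; omega
    rwa [this]
  rcases hK with rfl | rfl | rfl
  exacts [key splitC_hasSignature, key splitH_hasSignature, key splitO_hasSignature]

end CompAlg

end MagicSquare

theorem theorem4 :
    (∀ K₁ ∈ ({.R, .C, .H, .O} : Set MagicSquare.CompAlg),
      ∀ K₂ ∈ ({.R, .C, .H, .O} : Set MagicSquare.CompAlg),
        MagicSquare.LieIsomorphic (MagicSquare.L2 K₁ K₂) (MagicSquare.CompAlg.soSum K₁ K₂) ∧
        MagicSquare.LieIsomorphic (MagicSquare.L2 K₁ K₂)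
          (LieAlgebra.Orthogonal.so (Fin (K₁.dim + K₂.dim)) ℝ)) ∧
    (∀ K₁ ∈ ({.R, .C, .H, .O} : Set MagicSquare.CompAlg),
      ∀ K₂ ∈ ({.splitC, .splitH, .splitO} : Set MagicSquare.CompAlg),
        MagicSquare.LieIsomorphic (MagicSquare.L2 K₁ K₂)
          (LieAlgebra.Orthogonal.so' (Fin (K₁.dim + K₂.dim / 2)) (Fin (K₂.dim / 2)) ℝ)) := by
  refine ⟨fun K₁ h₁ K₂ h₂ => ?_, fun K₁ h₁ K₂ h₂ => ?_⟩
  · have s₁ := MagicSquare.CompAlg.hasSignature_dim h₁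
    have := s₁.finiteDimensional
    have h := MagicSquare.lieIsomorphic_soSum K₁ K₂
    -- The number of negative squares is 0 + 0, which is 0 by definition.
    obtain ⟨e⟩ := (MagicSquare.CompAlg.hasSignature_sumN s₁
      (MagicSquare.CompAlg.hasSignature_dim h₂)).exists_lieEquiv_so
    exact ⟨h, h.trans_lieEquiv e⟩
  · have s₁ := MagicSquare.CompAlg.hasSignature_dim h₁
    have := s₁.finiteDimensional
    have h := MagicSquare.lieIsomorphic_soSum K₁ K₂
    have s := MagicSquare.CompAlg.hasSignature_sumN s₁
      (MagicSquare.CompAlg.hasSignature_half_dim h₂)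
    -- K₁ is positive definite, so all negative squares come from the split algebra.
    rw [zero_add] at s
    obtain ⟨e⟩ := s.exists_lieEquiv_so'
    exact h.trans_lieEquiv e
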